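/- Let $n\ge 2$ be an integer. A translation-invariant total order (TITO) is a total order $\preceq$ on $\mathbb{Z}$ such that, for all $a,b\in\mathbb{Z}$, $a\preceq b$ if and only if $a+n\preceq b+n$. TITOs are partially ordered by containment of their inversion sets, where an inversion of $\preceq$ is a pair $(a,b)$ of integers with $a<b$ and $b\preceq a$, considered up to simultaneous translation by multiples of $n$. A TITO is $312$-avoiding if there are no integers $a<b<c$ with $c\preceq a\preceq b$. A block of a TITO is a nonempty order-convex subset $I\subseteq\mathbb{Z}$ that has no minimal and no maximal element and in which any two elements bound a finite interval; its size is the number of residue classes modulo $n$ that meet $I$, and it is waxing if $a\preceq a+n$ for $a\in I$. A TITO is real if each of its blocks of size $1$ is waxing. The cyclic Tamari lattice $\mathsf{CTam}$ is the poset of all $312$-avoiding TITOs, and the affine Tamari lattice $\mathsf{ATam}$ is the poset of all $312$-avoiding real TITOs. Then $\mathsf{CTam}$ and $\mathsf{ATam}$ are finite, and \[ |\mathsf{CTam}|=\binom{2n}{n}\qquad\text{and}\qquad |\mathsf{ATam}|=\frac{3n-2}{n}\binom{2n-2}{n-1}, \] the Catalan numbers of types $B_n$ and $D_n$, respectively.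 -/

import Mathlib

/-- A translation-invariant total order (TITO) with period `n`: a total order `le` on `ℤ`
such that `a ⪯ b` if and only if `a + n ⪯ b + n`. -/
@[ext]
structure TITO (n : ℕ) where
  le : ℤ → ℤ → Prop
  refl : ∀ a, le a a
  trans : ∀ a b c, le a b → le b c → le a c
  antisymm : ∀ a b, le a b → le b a → a = b
  total : ∀ a b, le a b ∨ le b a
  translate : ∀ a b, le a b ↔ le (a + n) (b + n)

namespace TITO

variable {n : ℕ}

/-- The inversion set of a TITO, as a set of pairs `a < b` with `b ⪯ a`. By translation
invariance this set is closed under simultaneous translation by multiples of `n`, so it carries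
the same information as the corresponding set of reflection indices (pairs up to translation),
and containment has the same meaning for both. -/
def inv (t : TITO n) : Set (ℤ × ℤ) := {p | p.1 < p.2 ∧ t.le p.2 p.1}

theorem inv_injective : Function.Injective (inv : TITO n → Set (ℤ × ℤ)) := by
  intro s t h
  have key : ∀ a b : ℤ, a < b → (s.le b a ↔ t.le b a) := fun a b hab => by
    have h1 : (a, b) ∈ s.inv ↔ (a, b) ∈ t.inv := by rw [h]
    simpa [inv, hab] using h1
  have not_le : ∀ (u : TITO n) (a b : ℤ), a < b → (u.le a b ↔ ¬ u.le b a) := fun u a b hab =>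
    ⟨fun h1 h2 => hab.ne (u.antisymm _ _ h1 h2), fun h1 => (u.total a b).resolve_right h1⟩
  ext a b
  rcases lt_trichotomy a b with hab | rfl | hab
  · rw [not_le s a b hab, not_le t a b hab, key a b hab]
  · exact ⟨fun _ => t.refl a, fun _ => s.refl a⟩
  · exact key b a hab

/-- The Dyer order: containment of inversion sets. With this order, `TITO n` is the cyclic Dyer
lattice `CDyer`. -/
instance : PartialOrder (TITO n) := PartialOrder.lift inv inv_injective

/-- A block of a TITO: a nonempty order-convex subset of `ℤ` with no minimal and no maximal
element, any two of whose elements bound a finite interval. -/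
structure IsBlock (t : TITO n) (I : Set ℤ) : Prop where
  nonempty : I.Nonempty
  convex : ∀ a ∈ I, ∀ c ∈ I, ∀ b, t.le a b → t.le b c → b ∈ I
  no_min : ∀ a ∈ I, ∃ b ∈ I, b ≠ a ∧ t.le b a
  no_max : ∀ a ∈ I, ∃ b ∈ I, b ≠ a ∧ t.le a b
  finite_interval : ∀ a ∈ I, ∀ c ∈ I, {b : ℤ | t.le a b ∧ t.le b c}.Finite

/-- The size of a block: the number of residue classes modulo `n` that meet it. -/
noncomputable def blockSize (n : ℕ) (I : Set ℤ) : ℕ := ((fun a : ℤ => (a : ZMod n)) '' I).ncard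

/-- A block is waxing if `a ⪯ a + n` for its elements `a`. -/
def IsWaxing (t : TITO n) (I : Set ℤ) : Prop := ∀ a ∈ I, t.le a (a + n)

/-- A TITO is real if each of its blocks of size `1` is waxing. -/
def IsReal (t : TITO n) : Prop := ∀ I : Set ℤ, t.IsBlock I → blockSize n I = 1 → t.IsWaxing I

/-- A TITO is `312`-avoiding if there are no integers `a < b < c` with `c ⪯ a ⪯ b`. -/
def Avoids312 (t : TITO n) : Prop :=
  ∀ a b c : ℤ, a < b → b < c → ¬ (t.le c a ∧ t.le a b)

end TITO

/-- The Dyer lattice: the subposet of real TITOs. -/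
abbrev Dyer (n : ℕ) : Type := {t : TITO n // t.IsReal}

/-- The cyclic Tamari lattice: the subposet of `312`-avoiding TITOs, under the Dyer order. -/
abbrev CTam (n : ℕ) : Type := {t : TITO n // t.Avoids312}

/-- The affine Tamari lattice: the subposet of the Dyer lattice of `312`-avoiding real TITOs. -/
abbrev ATam (n : ℕ) : Type := {t : Dyer n // t.1.Avoids312}

/-! Avoiding 312 means that the integers `c ≥ a` with `c ⪯ a` form an initial interval of `[a, ∞)`.
Read `a` as an opening bracket that closes where this interval ends, or never if it is infinite. The
order then becomes an `n`-periodic bracket word, determined by the number `g x` of closing brackets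
at each residue `x`. Every closing bracket is matched and each residue class of opening brackets
closes at most once per period, so `∑ g ≤ n`. Conversely, any such `g` gives a height walk, and `c ⪯
a` for `a < c` means that the walk stays above its value at `a` on `(a, c]`. These constructions are
inverse (`le_iff_staysAbove`, `closeCount_ofCloseCount`), so stars and bars with a slack variable
gives `(2n).choose n`. Brackets that never close form a waning block when the rise `n - ∑ g` is
positive. Its size is the rise, so reality fails exactly when `∑ g = n - 1`. This removes
`(2n-2).choose (n-1)` words. -/

open Finset

/-! ### Height functions -/

/-- The height function of a bracket word on the circle `ZMod n` in which every position `x` carries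
one opening bracket followed by `g x` closing brackets. -/
noncomputable def height {n : ℕ} (g : ZMod n → ℕ) (a : ℤ) : ℤ :=
  ∑ i ∈ Ico 0 a, (1 - (g i : ℤ)) - ∑ i ∈ Ico a 0, (1 - (g i : ℤ))

theorem Finset.sum_Ico_int_succ_top {M : Type*} [AddCommMonoid M] {a b : ℤ} (hab : a ≤ b)
    (f : ℤ → M) : ∑ i ∈ Ico a (b + 1), f i = ∑ i ∈ Ico a b, f i + f b := by
  have : Ico a (b + 1) = insert b (Ico a b) := by ext; simp; lia
  rw [this, sum_insert (by simp), add_comm]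

theorem Finset.sum_Ico_int_succ_bot {M : Type*} [AddCommMonoid M] {a b : ℤ} (hab : a < b)
    (f : ℤ → M) : ∑ i ∈ Ico a b, f i = f a + ∑ i ∈ Ico (a + 1) b, f i := by
  have : Ico a b = insert a (Ico (a + 1) b) := by ext; simp; lia
  rw [this, sum_insert (by simp)]

theorem ZMod.sum_eq_sum_Ico_int {M : Type*} [AddCommMonoid M] {n : ℕ} [NeZero n] (f : ZMod n → M) :
    ∑ x, f x = ∑ i ∈ Ico (0 : ℤ) n, f i := by
  refine sum_bij (fun x _ => (x.val : ℤ)) ?_ ?_ ?_ ?_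
  · intro x _
    exact mem_Ico.2 ⟨Int.natCast_nonneg _, by exact_mod_cast ZMod.val_lt x⟩
  · intro x _ y _ h
    exact ZMod.val_injective n (by exact_mod_cast h)
  · intro b hb
    rw [mem_Ico] at hb
    refine ⟨(b : ZMod n), mem_univ _, ?_⟩
    rw [ZMod.val_intCast, Int.emod_eq_of_lt hb.1 hb.2]
  · intro x _
    simp

section Height

variable {n : ℕ} (g : ZMod n → ℕ)

theorem height_succ (a : ℤ) : height g (a + 1) = height g a + 1 - g a := by
  unfold height
  rcases lt_or_ge a 0 with h | h
  · rw [sum_Ico_int_succ_bot h, Ico_eq_empty_of_le (a := 0) (b := a) h.le,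
      Ico_eq_empty_of_le (a := 0) (b := a + 1) (by lia)]
    simp only [sum_empty]
    ring
  · rw [sum_Ico_int_succ_top h, Ico_eq_empty_of_le (a := a) (b := 0) h,
      Ico_eq_empty_of_le (a := a + 1) (b := 0) (by lia)]
    simp only [sum_empty]
    ring

theorem height_zero : height g 0 = 0 := by simp [height]

theorem height_eq_add_sum {a d : ℤ} (h : a ≤ d) :
    height g d = height g a + (d - a) - ((∑ i ∈ Ico a d, g i : ℕ) : ℤ) := by
  induction d, h using Int.leInduction with
  | base => simp
  | succ d hd ih =>
    rw [height_succ, ih, sum_Ico_int_succ_top hd]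
    push_cast
    ring

theorem height_add_le {a d : ℤ} (h : a ≤ d) : height g d ≤ height g a + (d - a) := by
  rw [height_eq_add_sum g h]
  lia

/-- The last position before `c` at which the height is at most `v`. -/
theorem exists_last_height_eq {v c : ℤ} (hv : height g c ≤ v) {b : ℤ} (hb : c ≤ b) (hvb : v < height g (b + 1)) :
    ∃ e, c ≤ e ∧ e ≤ b ∧ height g e = v ∧ ∀ d, e < d → d ≤ b + 1 → v < height g d := by
  obtain ⟨e, ⟨he1, he2⟩, he3⟩ := Int.exists_greatest_of_bdd
    (P := fun e => height g e ≤ v ∧ e ≤ b) ⟨b, fun z hz => hz.2⟩ ⟨c, hv, hb⟩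
  have later (d : ℤ) (hd : e < d) (hdb : d ≤ b + 1) : v < height g d := by
    rcases hdb.eq_or_lt with rfl | hlt
    · exact hvb
    · by_contra! hle
      exact absurd (he3 d ⟨hle, by lia⟩) (by lia)
  -- The height climbs by at most one per step, so it cannot pass from below `v` to above `v`
  -- without taking the value `v`.
  have h1 := later (e + 1) (by lia) (by lia)
  have h2 := height_succ g e
  exact ⟨e, he3 c ⟨hv, hb⟩, he2, by lia, fun d hd hdb => later d hd hdb⟩

variable [NeZero n]

/-- The total increase of the height function over one period. -/
def periodRise (g : ZMod n → ℕ) : ℤ := n - ((∑ x, g x : ℕ) : ℤ)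

theorem height_add_period (a : ℤ) : height g (a + n) = height g a + periodRise g := by
  have step (b : ℤ) : height g (b + 1 + n) - height g (b + 1) = height g (b + n) - height g b := by
    have h1 := height_succ g b
    have h2 := height_succ g (b + n)
    rw [show b + n + 1 = b + 1 + n by ring, show ((b + n : ℤ) : ZMod n) = b by simp] at h2
    lia
  have base : height g (0 + n) - height g 0 = periodRise g := by
    rw [height_eq_add_sum g (a := 0) (d := 0 + n) (by lia), zero_add,
      periodRise, ← ZMod.sum_eq_sum_Ico_int g]
    lia
  have key : height g (a + n) - height g a = periodRise g := by
    induction a using Int.induction_on with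
    | zero => exact base
    | succ i ih => rw [step, ih]
    | pred i ih =>
      have := step (-(i : ℤ) - 1)
      rw [sub_add_cancel] at this
      rw [← this, ih]
  lia

theorem height_add_mul_period (a k : ℤ) : height g (a + k * n) = height g a + k * periodRise g := by
  induction k using Int.induction_on with
  | zero => simp
  | succ i ih =>
    rw [show a + ((i : ℤ) + 1) * n = a + i * n + n by ring, height_add_period, ih]
    ring
  | pred i ih =>
    have h := height_add_period g (a + (-(i : ℤ) - 1) * n)
    rw [show a + (-(i : ℤ) - 1) * n + n = a + -(i : ℤ) * n by ring, ih] at h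
    linarith

end Height

/-! ### The order defined by a height function -/

/-- The height function stays strictly above its value at `a` on the interval `(a, c]`. -/
def StaysAbove {n : ℕ} (g : ZMod n → ℕ) (a c : ℤ) : Prop :=
  ∀ d, a < d → d ≤ c → height g a < height g d

theorem StaysAbove.mono {n : ℕ} {g : ZMod n → ℕ} {a b c : ℤ} (h : StaysAbove g a c)
    (hbc : b ≤ c) : StaysAbove g a b := fun d h1 h2 => h d h1 (h2.trans hbc)

theorem StaysAbove.trans {n : ℕ} {g : ZMod n → ℕ} {a b c : ℤ} (h : StaysAbove g a b)
    (h' : StaysAbove g b c) (hab : a ≤ b) : StaysAbove g a c := by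
  intro d h1 h2
  rcases le_or_gt d b with hd | hd
  · exact h d h1 hd
  · rcases hab.eq_or_lt with rfl | hab
    · exact h' d hd h2
    · exact (h b hab le_rfl).trans (h' d hd h2)

theorem StaysAbove.refl {n : ℕ} (g : ZMod n → ℕ) (a : ℤ) : StaysAbove g a a :=
  fun d h1 h2 => absurd h1 (by lia)

theorem StaysAbove.add_period {n : ℕ} [NeZero n] {g : ZMod n → ℕ} {a c : ℤ} :
    StaysAbove g (a + n) (c + n) ↔ StaysAbove g a c := by
  constructor
  · intro h d h1 h2
    have := h (d + n) (by lia) (by lia)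
    rw [height_add_period, height_add_period] at this
    lia
  · intro h d h1 h2
    have := h (d - n) (by lia) (by lia)
    have h3 := height_add_period g (d - n)
    rw [sub_add_cancel] at h3
    rw [height_add_period]
    lia

namespace TITO

variable {n : ℕ}

theorem not_le_iff (t : TITO n) {a b : ℤ} (hab : a ≠ b) : ¬ t.le a b ↔ t.le b a :=
  ⟨(t.total a b).resolve_left, fun h h' => hab (t.antisymm _ _ h' h)⟩

theorem ext_of_inversions {s t : TITO n} (h : ∀ a c, a < c → (s.le c a ↔ t.le c a)) : s = t := by
  refine inv_injective (Set.ext fun p => and_congr_right fun hp => h p.1 p.2 hp)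

theorem le_add_mul_iff (t : TITO n) (a b k : ℤ) : t.le (a + k * n) (b + k * n) ↔ t.le a b := by
  induction k using Int.induction_on with
  | zero => simp
  | succ i ih =>
    rw [← ih, t.translate (a + i * n) (b + i * n)]
    ring_nf
  | pred i ih =>
    rw [← ih, t.translate (a + (-(i : ℤ) - 1) * n) (b + (-(i : ℤ) - 1) * n)]
    ring_nf

variable [NeZero n]

/-- The translation-invariant total order whose inversions are the pairs `a < c` such that the
height function of `g` stays strictly above its value at `a` on `(a, c]`. -/
def ofCloseCount (g : ZMod n → ℕ) : TITO n where
  le x y := (y ≤ x → StaysAbove g y x) ∧ (x < y → ¬ StaysAbove g x y)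
  refl a := ⟨fun _ => StaysAbove.refl g a, fun h => absurd h (lt_irrefl a)⟩
  trans x y z := by
    rintro ⟨h1, h2⟩ ⟨h3, h4⟩
    refine ⟨fun hzx => ?_, fun hxz h => ?_⟩
    · rcases le_or_gt y x with hyx | hxy
      · rcases le_or_gt z y with hzy | hyz
        · exact (h3 hzy).trans (h1 hyx) hzy
        · exact absurd ((h1 hyx).mono hzx) (h4 hyz)
      · exact (h3 (hzx.trans hxy.le)).mono hxy.le
    · rcases le_or_gt y x with hyx | hxy
      · exact h4 (hyx.trans_lt hxz) ((h1 hyx).trans h hyx)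
      · rcases le_or_gt z y with hzy | hyz
        · exact h2 hxy (h.trans (h3 hzy) hxz.le)
        · exact h2 hxy (h.mono hyz.le)
  antisymm x y := by
    rintro ⟨h1, h2⟩ ⟨h3, h4⟩
    rcases lt_trichotomy x y with h | h | h
    · exact absurd (h3 h.le) (h2 h)
    · exact h
    · exact absurd (h1 h.le) (h4 h)
  total x y := by
    rcases lt_trichotomy x y with h | rfl | h
    · by_cases hq : StaysAbove g x y
      · exact Or.inr ⟨fun _ => hq, fun h' => absurd h h'.not_gt⟩
      · exact Or.inl ⟨fun h' => absurd h h'.not_gt, fun _ => hq⟩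
    · exact Or.inl ⟨fun _ => StaysAbove.refl g x, fun h => absurd h (lt_irrefl x)⟩
    · by_cases hq : StaysAbove g y x
      · exact Or.inl ⟨fun _ => hq, fun h' => absurd h h'.not_gt⟩
      · exact Or.inr ⟨fun h' => absurd h h'.not_gt, fun _ => hq⟩
  translate a b := by
    simp only [StaysAbove.add_period, add_le_add_iff_right, add_lt_add_iff_right]

theorem ofCloseCount_le_of_le (g : ZMod n → ℕ) {a c : ℤ} (h : a ≤ c) :
    (ofCloseCount g).le c a ↔ StaysAbove g a c :=
  ⟨fun h' => h'.1 h, fun h' => ⟨fun _ => h', fun h'' => absurd h h''.not_ge⟩⟩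

theorem avoids312_ofCloseCount (g : ZMod n → ℕ) : (ofCloseCount g).Avoids312 := by
  rintro a b c hab hbc ⟨h1, h2⟩
  exact h2.2 hab (h1.1 (by lia) |>.mono hbc.le)

end TITO

/-! ### The bracket word of a `312`-avoiding order -/

namespace TITO

variable {n : ℕ} {t : TITO n}

theorem Avoids312.le_of_le (ht : t.Avoids312) {a b c : ℤ} (hab : a ≤ b) (hbc : b ≤ c)
    (h : t.le c a) : t.le b a := by
  rcases hab.eq_or_lt with rfl | hab
  · exact t.refl a
  rcases hbc.eq_or_lt with rfl | hbc
  · exact h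
  exact (t.not_le_iff hab.ne).1 fun h' => ht a b c hab hbc ⟨h, h'⟩

open Classical in
/-- The positions `a` such that `c` is the largest integer for which `[a, c]` consists of integers
weakly preceding `a`. The bounds on `a` are automatic for `312`-avoiding orders. -/
noncomputable def closers (t : TITO n) (c : ℤ) : Finset ℤ :=
  {a ∈ Ioc (c - n) c | t.le c a ∧ ¬ t.le (c + 1) a}

/-- If `a + n ≤ c`, then `a + n ⪯ a`, and translating gives `a + k * n ⪯ a` for all `k : ℕ`. Such a
bracket never closes, so the window `(c - n, c]` loses nothing. -/
theorem Avoids312.mem_closers [NeZero n] (ht : t.Avoids312) {a c : ℤ} :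
    a ∈ t.closers c ↔ a ≤ c ∧ t.le c a ∧ ¬ t.le (c + 1) a := by
  simp only [closers, mem_filter, mem_Ioc]
  refine ⟨fun h => ⟨h.1.2, h.2⟩, fun h => ⟨⟨?_, h.1⟩, h.2⟩⟩
  by_contra! hlt
  have hn : 0 < n := Nat.pos_of_neZero n
  have step : t.le (a + n) a := ht.le_of_le (by lia) (by lia) h.2.1
  have many (k : ℕ) : t.le (a + k * n) a := by
    induction k with
    | zero => simpa using t.refl a
    | succ k ih =>
      have h1 := (t.translate _ _).1 ih
      push_cast
      rw [show a + ((k : ℤ) + 1) * n = a + k * n + n by ring]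
      exact t.trans _ _ _ h1 step
  refine h.2.2 (ht.le_of_le (by lia) ?_ (many (c + 1 - a).toNat))
  rw [Int.toNat_of_nonneg (by lia)]
  nlinarith

theorem Avoids312.closers_disjoint [NeZero n] (ht : t.Avoids312) {b c c' : ℤ}
    (h : b ∈ t.closers c) (h' : b ∈ t.closers c') : c = c' := by
  rw [ht.mem_closers] at h h'
  rcases lt_trichotomy c c' with hlt | rfl | hlt
  · exact absurd (ht.le_of_le (by lia) (by lia) h'.2.1) h.2.2
  · rfl
  · exact absurd (ht.le_of_le (by lia) (by lia) h.2.1) h'.2.2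

theorem Avoids312.add_mul_mem_closers_iff [NeZero n] (ht : t.Avoids312) {a c : ℤ} (k : ℤ) :
    a + k * n ∈ t.closers (c + k * n) ↔ a ∈ t.closers c := by
  rw [ht.mem_closers, ht.mem_closers, t.le_add_mul_iff, add_right_comm, t.le_add_mul_iff,
    add_le_add_iff_right]

/-- The number of closing brackets at each position of the bracket word of `t`. -/
noncomputable def closeCount (t : TITO n) (x : ZMod n) : ℕ := #(t.closers x.val)

theorem Avoids312.closeCount_intCast [NeZero n] (ht : t.Avoids312) (c : ℤ) :
    t.closeCount c = #(t.closers c) := by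
  rw [closeCount, ZMod.val_intCast]
  refine card_bij (fun a _ => a + c / n * n) ?_ (fun a _ b _ h => by simpa using h) ?_
  · intro a ha
    rw [← ht.add_mul_mem_closers_iff (c / n)] at ha
    rwa [show c % n + c / n * n = c by rw [mul_comm]; exact Int.emod_add_mul_ediv c n] at ha
  · intro b hb
    refine ⟨b - c / n * n, ?_, by ring⟩
    rw [← ht.add_mul_mem_closers_iff (c / n), sub_add_cancel]
    rwa [show c % n + c / n * n = c by rw [mul_comm]; exact Int.emod_add_mul_ediv c n]

theorem Avoids312.sum_closeCount_Ico [NeZero n] (ht : t.Avoids312) (a d : ℤ) :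
    ∑ i ∈ Ico a d, t.closeCount i = #((Ico a d).biUnion t.closers) := by
  rw [card_biUnion]
  · exact sum_congr rfl fun i _ => ht.closeCount_intCast i
  · intro i _ j _ hij
    exact disjoint_left.2 fun b h h' => hij (ht.closers_disjoint h h')

theorem Avoids312.sum_closeCount_le [NeZero n] (ht : t.Avoids312) :
    ∑ x, t.closeCount x ≤ n := by
  rw [ZMod.sum_eq_sum_Ico_int, ht.sum_closeCount_Ico]
  have : n = #(univ : Finset (ZMod n)) := by simp
  conv_rhs => rw [this]
  -- Congruent opening brackets close at congruent positions, and one period contains only one of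
  -- these.
  refine card_le_card_of_injOn (fun b : ℤ => (b : ZMod n)) (fun _ _ => by simp) ?_
  intro b hb b' hb' h
  simp only [coe_biUnion, Set.mem_iUnion, mem_coe, mem_Ico] at hb hb'
  obtain ⟨c, hc, hb⟩ := hb
  obtain ⟨c', hc', hb'⟩ := hb'
  obtain ⟨k, hk⟩ := (ZMod.intCast_eq_intCast_iff_dvd_sub b b' n).1 h
  obtain rfl : b' = b + k * n := by linarith
  have := ht.closers_disjoint hb' ((ht.add_mul_mem_closers_iff k).2 hb)
  have hn : 0 < n := Nat.pos_of_neZero n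
  have h1 : k < 1 := by by_contra! hh; nlinarith
  have h2 : -1 < k := by by_contra! hh; nlinarith
  obtain rfl : k = 0 := by lia
  simp

theorem Avoids312.exists_mem_closers [NeZero n] (ht : t.Avoids312) {a c : ℤ} (hac : a ≤ c)
    (h : ¬ t.le c a) : ∃ e, a ≤ e ∧ e < c ∧ a ∈ t.closers e := by
  obtain ⟨e, ⟨h1, h2, h3⟩, h4⟩ := Int.exists_greatest_of_bdd
    (P := fun e => a ≤ e ∧ e ≤ c ∧ t.le e a) ⟨c, fun z hz => hz.2.1⟩ ⟨a, le_rfl, hac, t.refl a⟩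
  have hne : e ≠ c := by rintro rfl; exact h h3
  refine ⟨e, h1, by lia, ht.mem_closers.2 ⟨h1, h3, fun h' => ?_⟩⟩
  exact absurd (h4 (e + 1) ⟨by lia, by lia, h'⟩) (by lia)

/-- Brackets nest. While `a` is open, every bracket closed since `a` was opened after `a`, so the
height exceeds its value at `a`. When `a` closes at `e`, everything opened in `[a, e]` has closed
too, so the height at `e + 1` is no larger than at `a`. -/
theorem Avoids312.le_iff_staysAbove [NeZero n] (ht : t.Avoids312) {a c : ℤ} (hac : a ≤ c) :
    t.le c a ↔ StaysAbove t.closeCount a c := by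
  constructor
  · intro h d had hdc
    rw [height_eq_add_sum _ had.le, ht.sum_closeCount_Ico]
    have hsub : (Ico a d).biUnion t.closers ⊆ Ioo a d := by
      intro b hb
      simp only [mem_biUnion, mem_Ico, mem_Ioo] at hb ⊢
      obtain ⟨e, ⟨hae, hed⟩, hb⟩ := hb
      rw [ht.mem_closers] at hb
      refine ⟨?_, by lia⟩
      by_contra! hba
      exact hb.2.2 (t.trans _ _ _ (ht.le_of_le (by lia) (by lia) h)
        (ht.le_of_le hba hae hb.2.1))
    have := card_le_card hsub
    rw [Int.card_Ioo] at this
    lia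
  · intro h
    by_contra hn
    obtain ⟨e, hae, hec, he⟩ := ht.exists_mem_closers hac hn
    have hlt := h (e + 1) (by lia) (by lia)
    rw [height_eq_add_sum _ (show a ≤ e + 1 by lia), ht.sum_closeCount_Ico] at hlt
    have hsub : Ico a (e + 1) ⊆ (Ico a (e + 1)).biUnion t.closers := by
      intro b hb
      simp only [mem_biUnion, mem_Ico] at hb ⊢
      rw [ht.mem_closers] at he
      have hba := ht.le_of_le hb.1 (by lia) he.2.1
      obtain ⟨f, h1, h2, h3⟩ := ht.exists_mem_closers (a := b) (c := e + 1) (by lia)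
        fun h' => he.2.2 (t.trans _ _ _ h' hba)
      exact ⟨f, ⟨by lia, h2⟩, h3⟩
    have := card_le_card hsub
    rw [Int.card_Ico] at this
    lia

theorem Avoids312.ofCloseCount_closeCount [NeZero n] (ht : t.Avoids312) :
    ofCloseCount t.closeCount = t :=
  ext_of_inversions fun a c hac => by
    rw [ofCloseCount_le_of_le _ hac.le, ht.le_iff_staysAbove hac.le]

/-- The brackets closed at `c` are matched by height with the `g c` integers from `height g (c + 1)`
to `height g c`. -/
theorem closeCount_ofCloseCount [NeZero n] (g : ZMod n → ℕ) (hg : ∑ x, g x ≤ n) :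
    (ofCloseCount g).closeCount = g := by
  have ht := avoids312_ofCloseCount g
  funext x
  obtain ⟨c, rfl⟩ := ZMod.intCast_surjective x
  rw [ht.closeCount_intCast]
  have hs := height_succ g c
  have mem_iff {a : ℤ} : a ∈ (ofCloseCount g).closers c ↔
      a ≤ c ∧ StaysAbove g a c ∧ height g (c + 1) ≤ height g a := by
    rw [ht.mem_closers]
    refine and_congr_right fun hac => ?_
    rw [ofCloseCount_le_of_le g hac, ofCloseCount_le_of_le g (by lia)]
    refine and_congr_right fun h => ?_
    rw [← not_lt, not_iff_not]
    refine ⟨fun h' => h' (c + 1) (by lia) le_rfl, fun h' => ?_⟩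
    intro d h1 h2
    rcases h2.eq_or_lt with rfl | h2
    · exact h'
    · exact h d h1 (by lia)
  have hcard : #(Ico (height g (c + 1)) (height g c + 1)) = g c := by
    rw [Int.card_Ico]
    lia
  rw [← hcard]
  refine card_bij (fun a _ => height g a) ?_ ?_ ?_
  · intro a ha
    rw [mem_iff] at ha
    rw [mem_Ico]
    refine ⟨ha.2.2, ?_⟩
    rcases ha.1.eq_or_lt with rfl | h
    · lia
    · exact (ha.2.1 c h le_rfl).trans (by lia)
  · intro a ha b hb hab
    rw [mem_iff] at ha hb
    rcases lt_trichotomy a b with h | h | h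
    · exact absurd (ha.2.1 b h hb.1) (by lia)
    · exact h
    · exact absurd (hb.2.1 a h ha.1) (by lia)
  · intro v hv
    rw [mem_Ico] at hv
    rcases (show v ≤ height g c by lia).eq_or_lt with rfl | hlt
    · exact ⟨c, mem_iff.2 ⟨le_rfl, StaysAbove.refl g c, hv.1⟩, rfl⟩
    -- Since `∑ g ≤ n`, one period before `c + 1` the height is at most `v`, so a last position at
    -- height `v` exists. For `n = 1` the range of positions would be empty, but then `v < height g
    -- c` is impossible.
    have hper := height_add_period g (c + 1 - n)
    rw [sub_add_cancel] at hper
    have hrise : 0 ≤ periodRise g := by unfold periodRise; lia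
    have hn : 0 < n := Nat.pos_of_neZero n
    obtain ⟨e, -, h2, h3, h4⟩ := exists_last_height_eq g (v := v) (c := c + 1 - n) (b := c - 1)
      (by lia) (by
        by_contra! hh
        obtain rfl : n = 1 := by lia
        simp only [Nat.cast_one, add_sub_cancel_right] at hper
        lia) (by simpa using hlt)
    refine ⟨e, mem_iff.2 ⟨by lia, fun d hd hdc => ?_, by lia⟩, h3⟩
    rw [h3]
    exact h4 d hd (by lia)

/-- `312`-avoiding orders correspond to bracket words on the circle with at most `n` closing
brackets. -/
noncomputable def ctamEquiv (n : ℕ) [NeZero n] : CTam n ≃ {g : ZMod n → ℕ // ∑ x, g x ≤ n} where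
  toFun t := ⟨t.1.closeCount, t.2.sum_closeCount_le⟩
  invFun g := ⟨ofCloseCount g.1, avoids312_ofCloseCount g.1⟩
  left_inv t := Subtype.ext t.2.ofCloseCount_closeCount
  right_inv g := Subtype.ext (closeCount_ofCloseCount g.1 g.2)

end TITO

/-! ### Real orders -/

section Final

variable {n : ℕ} [NeZero n] {g : ZMod n → ℕ}

/-- A positive rise forces the height to `±∞` at `±∞`, so every level has a last visit. -/
theorem exists_final_height_eq (hg : 0 < periodRise g) (v : ℤ) :
    ∃ e, height g e = v ∧ ∀ d, e < d → v < height g d := by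
  have hn : 0 < n := Nat.pos_of_neZero n
  have lower (z : ℤ) : (z / n + 1) * periodRise g - n ≤ height g z := by
    have h1 := height_add_mul_period g 0 (z / n + 1)
    rw [height_zero, zero_add, zero_add] at h1
    have h2 := Int.emod_add_mul_ediv z n
    have h3 := Int.emod_nonneg z (b := n) (by lia)
    have h4 := Int.emod_lt_of_pos z (b := n) (by lia)
    have h5 : (z / n + 1) * n = n * (z / n) + n := by ring
    have := height_add_le g (a := z) (d := (z / n + 1) * n) (by lia)
    lia
  have large (z : ℤ) (hz : (|v| + n) * n ≤ z) : v < height g z := by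
    have h1 : |v| + n ≤ z / n := (Int.le_ediv_iff_mul_le (by lia)).2 hz
    have h2 := lower z
    have h3 := abs_nonneg v
    have h4 := le_abs_self v
    nlinarith
  have hlow : height g (0 + (-|v|) * n) ≤ v := by
    rw [height_add_mul_period, height_zero]
    have h3 := abs_nonneg v
    have h4 := neg_abs_le v
    nlinarith
  set b := (|v| + n) * n with hb
  have hcb : 0 + (-|v|) * n ≤ b := by
    have h3 := abs_nonneg v
    nlinarith
  obtain ⟨e, -, h2, h3, h4⟩ := exists_last_height_eq g hlow hcb (large (b + 1) (by lia))
  refine ⟨e, h3, fun d hd => ?_⟩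
  rcases le_or_gt d (b + 1) with h | h
  · exact h4 d hd h
  · exact large d (by lia)

theorem not_isReal_of_periodRise_eq_one (hg : periodRise g = 1) :
    ¬ (TITO.ofCloseCount g).IsReal := by
  have hn : 0 < n := Nat.pos_of_neZero n
  set t := TITO.ofCloseCount g
  -- `W` is the set of brackets that never close. It is an upper set for `⪯`, on which `⪯` reverses
  -- the usual order.
  set W : Set ℤ := {a | ∀ d, a < d → height g a < height g d} with hW
  have le_of_mem {a d : ℤ} (ha : a ∈ W) (h : a ≤ d) : t.le d a :=
    (TITO.ofCloseCount_le_of_le g h).2 fun e h1 _ => ha e h1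
  have upper {a b : ℤ} (ha : a ∈ W) (hab : t.le a b) : b ∈ W := by
    rcases le_or_gt b a with h | h
    · intro d hd
      rcases le_or_gt d a with hda | hda
      · exact hab.1 h d hd hda
      · rcases h.eq_or_lt with rfl | h
        · exact ha d hda
        · exact (hab.1 h.le a h le_rfl).trans (ha d hda)
    · exact absurd (t.antisymm _ _ hab (le_of_mem ha h.le)) h.ne
  have add_mem {a : ℤ} (ha : a ∈ W) (k : ℤ) : a + k * n ∈ W := by
    intro d hd
    have h1 := ha (d - k * n) (by lia)
    have h2 := height_add_mul_period g (d - k * n) k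
    rw [sub_add_cancel] at h2
    rw [height_add_mul_period]
    lia
  obtain ⟨a₀, h0, h1⟩ := exists_final_height_eq (g := g) (by lia) 0
  have ha₀ : a₀ ∈ W := fun d hd => h0 ▸ h1 d hd
  have block : t.IsBlock W :=
    { nonempty := ⟨a₀, ha₀⟩
      convex := fun a ha _ _ b hab _ => upper ha hab
      no_min := fun a ha => ⟨a + 1 * n, add_mem ha 1, by lia, le_of_mem ha (by lia)⟩
      no_max := fun a ha => ⟨a + (-1) * n, add_mem ha (-1), by lia,
        le_of_mem (add_mem ha (-1)) (by lia)⟩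
      finite_interval := by
        intro a ha c hc
        refine (Set.finite_Icc c a).subset ?_
        rintro b ⟨hab, hbc⟩
        have hb := upper ha hab
        constructor
        · by_contra! h
          exact h.ne (t.antisymm _ _ hbc (le_of_mem hb h.le))
        · by_contra! h
          exact h.ne (t.antisymm _ _ hab (le_of_mem ha h.le)) }
  have size : TITO.blockSize n W = 1 := by
    rw [TITO.blockSize, Set.ncard_eq_one]
    refine ⟨(a₀ : ZMod n), Set.eq_singleton_iff_unique_mem.2 ⟨⟨a₀, ha₀, rfl⟩, ?_⟩⟩
    rintro _ ⟨a, ha, rfl⟩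
    -- Distinct elements of `W` have distinct heights. A shift by `n` raises the height by one, so
    -- the translates of `a₀` already use every height.
    have heq : height g (a₀ + height g a * n) = height g a := by
      rw [height_add_mul_period, h0, hg]
      ring
    have hmem := add_mem ha₀ (height g a)
    have : a = a₀ + height g a * n := by
      rcases lt_trichotomy a (a₀ + height g a * n) with h | h | h
      · exact absurd (ha _ h) (by lia)
      · exact h
      · exact absurd (hmem _ h) (by lia)
    show (a : ZMod n) = a₀
    rw [this]
    simp
  intro hreal
  have h2 := hreal W block size a₀ ha₀
  have := t.antisymm _ _ h2 (le_of_mem ha₀ (by lia))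
  lia

/-- A non-waxing block of size 1 would force a rise of at least 2. Some other never-closing bracket
then lies strictly between `a` and `a + n`, and convexity puts it in the block. -/
theorem isReal_of_periodRise_ne_one (hg : periodRise g ≠ 1) : (TITO.ofCloseCount g).IsReal := by
  have hn : 0 < n := Nat.pos_of_neZero n
  set t := TITO.ofCloseCount g
  intro I hI hsize a ha
  by_contra hwax
  have congr {b c : ℤ} (hb : b ∈ I) (hc : c ∈ I) : ∃ k : ℤ, c = b + k * n := by
    obtain ⟨x, hx⟩ := Set.ncard_eq_one.1 hsize
    have h1 : (b : ZMod n) = x := by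
      simpa using hx.subset (Set.mem_image_of_mem (fun a : ℤ => (a : ZMod n)) hb)
    have h2 : (c : ZMod n) = x := by
      simpa using hx.subset (Set.mem_image_of_mem (fun a : ℤ => (a : ZMod n)) hc)
    obtain ⟨k, hk⟩ := (ZMod.intCast_eq_intCast_iff_dvd_sub b c n).1 (h1.trans h2.symm)
    exact ⟨k, by linarith⟩
  have habove : StaysAbove g a (a + n) :=
    (TITO.ofCloseCount_le_of_le g (by lia)).1 ((t.not_le_iff (by lia)).1 hwax)
  have hrise : 2 ≤ periodRise g := by
    have h1 := habove (a + n) (by lia) le_rfl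
    rw [height_add_period] at h1
    lia
  have haW : ∀ d, a < d → height g a < height g d := by
    intro d hd
    have h1 := Int.emod_add_mul_ediv (d - a - 1) n
    have h2 := Int.emod_nonneg (d - a - 1) (b := n) (by lia)
    have h3 := Int.emod_lt_of_pos (d - a - 1) (b := n) (by lia)
    have h4 : 0 ≤ (d - a - 1) / n := Int.ediv_nonneg (by lia) (by lia)
    have h5 := habove (a + 1 + (d - a - 1) % n) (by lia) (by lia)
    have h6 := height_add_mul_period g (a + 1 + (d - a - 1) % n) ((d - a - 1) / n)
    rw [show a + 1 + (d - a - 1) % n + (d - a - 1) / n * n = d by linarith] at h6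
    nlinarith
  -- The level one above `a` is still below that of `a + n`, which confines its last visit to `(a, a
  -- + n)`.
  obtain ⟨b, hb, hbW⟩ := exists_final_height_eq (g := g) (by lia) (height g a + 1)
  have le_of_final {b d : ℤ} (hb : ∀ d, b < d → height g b < height g d) (h : b ≤ d) : t.le d b :=
    (TITO.ofCloseCount_le_of_le g h).2 fun e h1 _ => hb e h1
  have hab : a < b := by
    by_contra! h
    rcases h.eq_or_lt with rfl | h
    · lia
    · have := hbW a h
      lia
  have hban : b < a + n := by
    by_contra! h
    have h1 := height_add_period g (b - n)
    rw [sub_add_cancel] at h1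
    rcases h.eq_or_lt with rfl | h
    · rw [add_sub_cancel_right] at h1
      lia
    · have := haW (b - n) (by lia)
      lia
  obtain ⟨a', ha', hne, hle⟩ := hI.no_min a ha
  obtain ⟨k, rfl⟩ := congr ha ha'
  have hk : 1 ≤ k := by
    by_contra! h
    have hk0 : k ≠ 0 := by rintro rfl; simp at hne
    have h1 : a + k * n < a := by
      have : k ≤ -1 := by lia
      nlinarith
    have h2 : ∀ d, a + k * n < d → height g (a + k * n) < height g d := by
      intro d hd
      have h1 := haW (d - k * n) (by lia)
      have h2 := height_add_mul_period g (d - k * n) k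
      rw [sub_add_cancel] at h2
      rw [height_add_mul_period]
      lia
    exact hne (t.antisymm _ _ hle (le_of_final h2 h1.le))
  have hbI : b ∈ I := hI.convex _ ha' a ha b
    (le_of_final (hb ▸ hbW) (by nlinarith)) (le_of_final haW hab.le)
  obtain ⟨m, hm⟩ := congr ha hbI
  have h1 : 0 < m := by by_contra! h; nlinarith
  have h2 : m < 1 := by by_contra! h; nlinarith
  lia

end Final

/-! ### Counting -/

theorem card_sum_eq (α : Type*) [Fintype α] [DecidableEq α] (k : ℕ) :
    Nat.card {g : α → ℕ // ∑ x, g x = k} = (Fintype.card α).multichoose k := by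
  rw [← Nat.card_congr (Sym.equivNatSumOfFintype α k), Nat.card_eq_fintype_card,
    Sym.card_sym_eq_multichoose]

/-- Functions with sum at most `k` correspond to functions on `Option α` with sum `k`. -/
def sumLeEquivOption (α : Type*) [Fintype α] (k : ℕ) :
    {g : α → ℕ // ∑ x, g x ≤ k} ≃ {g : Option α → ℕ // ∑ x, g x = k} where
  toFun g := ⟨fun x => x.elim (k - ∑ y, g.1 y) g.1, by
    rw [Fintype.sum_option]
    exact Nat.sub_add_cancel g.2⟩
  invFun g := ⟨fun x => g.1 (some x), by
    have := g.2
    rw [Fintype.sum_option] at this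
    lia⟩
  left_inv g := rfl
  right_inv g := by
    ext x
    cases x with
    | none =>
      have := g.2
      rw [Fintype.sum_option] at this
      simp only [Option.elim]
      lia
    | some x => rfl

theorem card_sum_le (α : Type*) [Fintype α] [DecidableEq α] (k : ℕ) :
    Nat.card {g : α → ℕ // ∑ x, g x ≤ k} = (Fintype.card α + 1).multichoose k := by
  rw [Nat.card_congr (sumLeEquivOption α k), card_sum_eq, Fintype.card_option]

theorem centralBinom_eq_div_mul (m : ℕ) :
    ((2 * (m + 1)).choose (m + 1) : ℚ) = (4 * m + 2) / (m + 1) * ((2 * m).choose m : ℚ) := by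
  have h := Nat.succ_mul_centralBinom_succ m
  rw [Nat.centralBinom, Nat.centralBinom] at h
  have h' : ((m : ℚ) + 1) * ((2 * (m + 1)).choose (m + 1) : ℕ) =
      2 * (2 * m + 1) * ((2 * m).choose m : ℕ) := by exact_mod_cast h
  rw [div_mul_eq_mul_div, eq_div_iff (by positivity)]
  linarith

theorem card_ctam (n : ℕ) [NeZero n] : Nat.card (CTam n) = (2 * n).choose n := by
  rw [Nat.card_congr (TITO.ctamEquiv n), card_sum_le, ZMod.card, Nat.multichoose_eq]
  congr 1
  lia

theorem isReal_iff_sum_closeCount {n : ℕ} [NeZero n] (t : CTam n) :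
    t.1.IsReal ↔ ∑ x, t.1.closeCount x ≠ n - 1 := by
  have hn : 0 < n := Nat.pos_of_neZero n
  have hle := t.2.sum_closeCount_le
  have key : periodRise t.1.closeCount = 1 ↔ ∑ x, t.1.closeCount x = n - 1 := by
    unfold periodRise
    lia
  rw [ne_eq, ← key]
  conv_lhs => rw [← t.2.ofCloseCount_closeCount]
  exact ⟨fun h h' => not_isReal_of_periodRise_eq_one h' h, isReal_of_periodRise_ne_one⟩

theorem card_not_isReal (n : ℕ) [NeZero n] :
    Nat.card {t : CTam n // ¬ t.1.IsReal} = (2 * (n - 1)).choose (n - 1) := by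
  have e : {t : CTam n // ¬ t.1.IsReal} ≃ {g : ZMod n → ℕ // ∑ x, g x = n - 1} :=
    ((TITO.ctamEquiv n).subtypeEquiv (q := fun g => ∑ x, g.1 x = n - 1) fun t => by
      rw [isReal_iff_sum_closeCount, not_not]
      rfl).trans
      (Equiv.subtypeSubtypeEquivSubtype (p := fun g : ZMod n → ℕ => ∑ x, g x ≤ n)
        (q := fun g => ∑ x, g x = n - 1) fun {g} h => by lia)
  rw [Nat.card_congr e, card_sum_eq, ZMod.card, Nat.multichoose_eq]
  congr 1
  lia

theorem card_atam_add (n : ℕ) [NeZero n] :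
    Nat.card (ATam n) + (2 * (n - 1)).choose (n - 1) = (2 * n).choose n := by
  -- `Nat.card` is zero on infinite types, so a positive count yields the finiteness needed to add
  -- cardinalities.
  have hfin : Finite (CTam n) := Nat.finite_of_card_ne_zero <| by
    rw [card_ctam]
    exact (Nat.choose_pos (by lia)).ne'
  have e : ATam n ≃ {t : CTam n // t.1.IsReal} :=
    { toFun := fun t => ⟨⟨t.1.1, t.2⟩, t.1.2⟩
      invFun := fun t => ⟨⟨t.1.1, t.2⟩, t.1.2⟩
      left_inv := fun _ => rfl
      right_inv := fun _ => rfl }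
  classical
  rw [← card_not_isReal, Nat.card_congr e, ← Nat.card_sum,
    Nat.card_congr (Equiv.sumCompl fun t : CTam n => t.1.IsReal), card_ctam]

/-- Finiteness of both posets is implicit: both right-hand sides are nonzero, while `Nat.card` of an
infinite type is zero. -/
theorem mainTheorem6 (n : ℕ) (hn : 2 ≤ n) :
    Nat.card (CTam n) = (2 * n).choose n ∧
    (Nat.card (ATam n) : ℚ) = (3 * (n : ℚ) - 2) / n * ((2 * n - 2).choose (n - 1) : ℚ) := by
  obtain ⟨m, rfl⟩ := Nat.exists_eq_add_of_le' (show 1 ≤ n by lia)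
  refine ⟨card_ctam _, ?_⟩
  have h : (Nat.card (ATam (m + 1)) : ℚ) + ((2 * m).choose m : ℚ) =
      ((2 * (m + 1)).choose (m + 1) : ℚ) := by exact_mod_cast card_atam_add (m + 1)
  rw [centralBinom_eq_div_mul] at h
  rw [show 2 * (m + 1) - 2 = 2 * m by lia, Nat.add_sub_cancel, eq_sub_of_add_eq h]
  have hm : (m : ℚ) + 1 ≠ 0 := by positivity
  -- With `n = m + 1`, what remains is `(4m + 2)/(m + 1) - 1 = (3m + 1)/(m + 1)`.
  push_cast
  field_simp
  ring
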